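/- Let $k \ge 2$ and $N \ge 1$ be integers, and let $\Sigma_k = \{0, 1, \ldots, k-1\}$. For a word $w = w_0 w_1 \cdots w_{N-1} \in \Sigma_k^N$ and $0 \le i \le N$, let $\gamma_i(w)$ denote the number of distinct circular factors of $w$ of length $i$, that is, the number of distinct words $w_j w_{j+1} \cdots w_{j+i-1}$ with $0 \le j < N$, where the indices are taken modulo $N$. A word $w \in \Sigma_k^N$ is called a generalized de Bruijn word if $\gamma_i(w) = \min(k^i, N)$ for all $0 \le i \le N$. For all integers $k \ge 2$ and $N \ge 1$ there exists a generalized de Bruijn word of length $N$ over the $k$-letter alphabet $\Sigma_k$. -/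

import Mathlib

/-- The circular factor of length `i` of the word `w = w₀ w₁ ⋯ w_{N-1}` that starts at position
`j`, that is `w_j w_{j+1} ⋯ w_{j+i-1}` with indices taken modulo `N`. -/
def circularFactor {A : Type*} {N : ℕ} (w : Fin N → A) (i : ℕ) (j : Fin N) : Fin i → A :=
  fun t => w ⟨((j : ℕ) + (t : ℕ)) % N, Nat.mod_lt _ j.pos⟩

/-- The number of distinct circular factors of length `i` of the word `w`. -/
def circularComplexity {A : Type*} [DecidableEq A] {N : ℕ} (w : Fin N → A) (i : ℕ) : ℕ :=
  (Finset.univ.image (circularFactor w i)).card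

/-- A word `w` of length `N` over the alphabet `{0, …, k-1}` is a generalized de Bruijn word if
for each `0 ≤ i ≤ N` it has exactly `min (k ^ i) N` distinct circular factors of length `i`. -/
def IsGeneralizedDeBruijn {k N : ℕ} (w : Fin N → Fin k) : Prop :=
  ∀ i : ℕ, i ≤ N → circularComplexity w i = min (k ^ i) N

open Equiv

/-! Let `k ^ n ≤ N < k ^ (n + 1)`. It suffices that all words of length `n` occur and that the
factors of length `n + 1` are distinct. Allow several circular words at once, as the cycles of a
permutation. Such codings arise by induction on `n` (`exists_isDeBruijnCoding`): inverting the
difference map lifts each point of a coding of size `N / k` to `k` points, and `N % k` constant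
words are added. Swaps then join the cycles (`IsDeBruijnCoding.exists_sameCycle`). -/

/-- The `t`-th letter of the word read off from `p` by iterating `σ`. -/
def orbitLetter {I A : Type*} (σ : Perm I) (l : I → A) (p : I) (t : ℕ) : A := l ((σ ^ t) p)

theorem orbitLetter_succ {I A : Type*} (σ : Perm I) (l : I → A) (p : I) (t : ℕ) :
    orbitLetter σ l p (t + 1) = orbitLetter σ l (σ p) t := by
  simp [orbitLetter, pow_succ]

/-- The words of length `n + 1` read off from the points of `I` are distinct, and every word of
length `n` is read off from some point. -/
structure IsDeBruijnCoding {I A : Type*} (n : ℕ) (σ : Perm I) (l : I → A) : Prop where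
  eq_of_agree : ∀ p q, (∀ t < n + 1, orbitLetter σ l p t = orbitLetter σ l q t) → p = q
  exists_word : ∀ u : ℕ → A, ∃ p, ∀ t < n, orbitLetter σ l p t = u t

section Lift

/-- The skew product of `σ` with the partial sums of the letters, together with `r` fixed points. -/
def liftPerm {I A : Type*} [AddGroup A] (σ : Perm I) (l : I → A) (r : ℕ) :
    Perm ((I × A) ⊕ Fin r) :=
  Equiv.sumCongr (Equiv.prodShear σ fun i => Equiv.addRight (l i)) (Equiv.refl _)

/-- The letters of `liftPerm`: the second coordinate, and `c + 1` at the fixed point `c`. -/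
def liftLetter {I : Type*} {k : ℕ} [NeZero k] (r : ℕ) : (I × Fin k) ⊕ Fin r → Fin k :=
  Sum.elim Prod.snd fun c => Fin.ofNat k ((c : ℕ) + 1)

variable {I : Type*} {k : ℕ} [NeZero k] (σ : Perm I) (l : I → Fin k) (r : ℕ)

theorem liftPerm_pow_inr (c : Fin r) (t : ℕ) :
    (liftPerm σ l r ^ t) (Sum.inr c) = Sum.inr c := by
  induction t with
  | zero => rfl
  | succ t ih => rw [pow_succ', Perm.mul_apply, ih]; rfl

theorem orbitLetter_lift_inr (c : Fin r) (t : ℕ) :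
    orbitLetter (liftPerm σ l r) (liftLetter r) (Sum.inr c) t = Fin.ofNat k ((c : ℕ) + 1) := by
  rw [orbitLetter, liftPerm_pow_inr]; rfl

theorem orbitLetter_lift_inl_succ (i : I) (x : Fin k) (t : ℕ) :
    orbitLetter (liftPerm σ l r) (liftLetter r) (Sum.inl (i, x)) (t + 1) =
      orbitLetter (liftPerm σ l r) (liftLetter r) (Sum.inl (i, x)) t + orbitLetter σ l i t := by
  induction t generalizing i x with
  | zero => rfl
  | succ t ih =>
    rw [orbitLetter_succ]
    refine (ih (σ i) (x + l i)).trans ?_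
    rw [orbitLetter_succ σ l i, orbitLetter_succ (liftPerm σ l r)]
    rfl

end Lift

theorem Fin.ofNat_succ_inj {k a b : ℕ} [NeZero k] (ha : a + 1 < k) (hb : b + 1 < k)
    (h : Fin.ofNat k (a + 1) = Fin.ofNat k (b + 1)) : a = b := by
  have := congrArg Fin.val h
  simp only [Fin.val_ofNat, Nat.mod_eq_of_lt ha, Nat.mod_eq_of_lt hb] at this
  omega

theorem Fin.ofNat_succ_ne_zero {k a : ℕ} [NeZero k] (ha : a + 1 < k) :
    Fin.ofNat k (a + 1) ≠ 0 := by
  intro h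
  have := congrArg Fin.val h
  simp [Nat.mod_eq_of_lt ha] at this

/-- Codings of every size exist, even without the zero word of length `n + 1`. -/
theorem exists_isDeBruijnCoding {k : ℕ} [NeZero k] (n : ℕ) :
    ∀ N, k ^ n ≤ N → N < k ^ (n + 1) →
      ∃ (I : Type) (_ : Fintype I) (σ : Perm I) (l : I → Fin k), Fintype.card I = N ∧
        IsDeBruijnCoding n σ l ∧ ∀ p, ∃ t < n + 1, orbitLetter σ l p t ≠ 0 := by
  induction n with
  | zero =>
    intro N h1 h2
    have hlt (i : Fin N) : (i : ℕ) + 1 < k := by have := i.2; simp at h2; omega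
    refine ⟨Fin N, inferInstance, 1, fun i => Fin.ofNat k ((i : ℕ) + 1), by simp,
      ⟨fun p q h => ?_, fun u => ⟨⟨0, by simp at h1; omega⟩, by simp⟩⟩, fun p => ⟨0, by simp, ?_⟩⟩
    · exact Fin.ext (Fin.ofNat_succ_inj (hlt p) (hlt q) (h 0 (by simp)))
    · exact Fin.ofNat_succ_ne_zero (hlt p)
  | succ n ih =>
    intro N h1 h2
    have hk : 0 < k := Nat.pos_of_ne_zero (NeZero.ne k)
    obtain ⟨I, _, σ, l, hcard, hc, hz⟩ := ih (N / k)
      ((Nat.le_div_iff_mul_le hk).2 (by rwa [← pow_succ]))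
      ((Nat.div_lt_iff_lt_mul hk).2 (by rwa [← pow_succ]))
    by_cases hr : ∃ c : Fin (N % k), ¬ (c : ℕ) + 1 < k
    · obtain ⟨c, hc⟩ := hr
      have := c.2
      have := Nat.mod_lt N hk
      omega
    push Not at hr
    -- A constant lift would have zero differences, but the zero word is excluded, so the added
    -- constant words are new.
    have hconst (i : I) (x b : Fin k) : ¬ ∀ t < n + 1 + 1,
        orbitLetter (liftPerm σ l (N % k)) (liftLetter _) (Sum.inl (i, x)) t = b := by
      intro h
      obtain ⟨t, ht, hne⟩ := hz i
      have e := orbitLetter_lift_inl_succ σ l (N % k) i x t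
      rw [h t (by omega), h (t + 1) (by omega)] at e
      exact hne (by simpa using e)
    refine ⟨(I × Fin k) ⊕ Fin (N % k), inferInstance, liftPerm σ l _, liftLetter _, ?_,
      ⟨?_, fun u => ?_⟩, ?_⟩
    · simp [hcard, Nat.div_add_mod']
    · rintro (⟨i, x⟩ | c) (⟨j, y⟩ | d) h
      · have hxy : x = y := h 0 (by omega)
        have hij : i = j := hc.eq_of_agree i j fun t ht => by
          have e := h (t + 1) (by omega)
          rw [orbitLetter_lift_inl_succ, orbitLetter_lift_inl_succ, h t (by omega)] at e
          exact add_left_cancel e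
        rw [hxy, hij]
      · exact (hconst i x _ fun t ht => (h t ht).trans (orbitLetter_lift_inr ..)).elim
      · exact (hconst j y _ fun t ht => (h t ht).symm.trans (orbitLetter_lift_inr ..)).elim
      · have e := h 0 (by omega)
        rw [orbitLetter_lift_inr, orbitLetter_lift_inr] at e
        rw [Fin.ext (Fin.ofNat_succ_inj (hr c) (hr d) e)]
    · obtain ⟨i, hi⟩ := hc.exists_word fun t => u (t + 1) - u t
      refine ⟨Sum.inl (i, u 0), fun t => ?_⟩
      induction t with
      | zero => intro _; rfl
      | succ t iht =>
        intro ht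
        rw [orbitLetter_lift_inl_succ, iht (by omega), hi t (by omega)]
        abel
    · rintro (⟨i, x⟩ | c)
      · by_contra! h
        exact hconst i x 0 h
      · exact ⟨0, by omega, by
          rw [orbitLetter_lift_inr]; exact Fin.ofNat_succ_ne_zero (hr c)⟩

/-! ### Joining cycles by a swap -/

section Merge

variable {I : Type*}

theorem Equiv.Perm.SameCycle.of_apply {σ τ : Perm I} (h : ∀ x, τ.SameCycle x (σ x)) {x y : I}
    (hxy : σ.SameCycle x y) : τ.SameCycle x y := by
  obtain ⟨i, rfl⟩ := hxy
  induction i with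
  | zero => exact Perm.SameCycle.refl _ _
  | succ i ih =>
    rw [add_comm, zpow_add, zpow_one, Perm.mul_apply]
    exact ih.trans (h _)
  | pred i ih =>
    refine ih.trans ?_
    have := h ((σ ^ (-(i : ℤ) - 1)) x)
    rw [← Perm.mul_apply, ← zpow_one_add, add_sub_cancel] at this
    exact this.symm

variable [Finite I] [DecidableEq I] {σ : Perm I} {p q : I}

/-- Swapping the images of two points in distinct cycles joins these cycles. -/
theorem Equiv.Perm.sameCycle_mul_swap (h : ¬ σ.SameCycle p q) :
    (σ * swap p q).SameCycle q p := by
  -- From `q` the new permutation jumps to `σ p` and follows the old cycle of `p`, which avoids `q`.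
  have key : ∀ j : ℕ, (σ * swap p q).SameCycle q ((σ ^ (j + 1)) p) := by
    intro j
    induction j with
    | zero => exact ⟨1, by simp⟩
    | succ j ih =>
      rw [pow_succ', Perm.mul_apply]
      set x := (σ ^ (j + 1)) p with hx
      by_cases hxp : x = p
      · rw [hxp]; exact ⟨1, by simp⟩
      · have hxq : x ≠ q := fun e => h ⟨(j + 1 : ℕ), by rw [zpow_natCast]; exact e⟩
        have : (σ * swap p q) x = σ x := by simp [swap_apply_of_ne_of_ne hxp hxq]
        rw [← this]
        exact Perm.sameCycle_apply_right.2 ih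
  have := key (orderOf σ - 1)
  rwa [Nat.sub_add_cancel (orderOf_pos σ), pow_orderOf_eq_one] at this

theorem Equiv.Perm.SameCycle.mul_swap (h : ¬ σ.SameCycle p q) {x y : I}
    (hxy : σ.SameCycle x y) : (σ * swap p q).SameCycle x y := by
  refine hxy.of_apply fun x => ?_
  have hqp := Perm.sameCycle_mul_swap h
  by_cases hp : x = p
  · subst hp; exact hqp.symm.trans ⟨1, by simp⟩
  by_cases hq : x = q
  · subst hq; exact hqp.trans ⟨1, by simp⟩
  · exact ⟨1, by simp [swap_apply_of_ne_of_ne hp hq]⟩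

end Merge

/-! ### Swaps that preserve a coding -/

section Words

variable {I A : Type*} [DecidableEq I] {σ : Perm I} {l : I → A} {p q : I} {n : ℕ}

theorem orbitLetter_mul_swap {m : ℕ}
    (h : ∀ t < m, orbitLetter σ l (σ p) t = orbitLetter σ l (σ q) t) :
    ∀ t ≤ m, ∀ x, orbitLetter (σ * swap p q) l x t = orbitLetter σ l x t := by
  intro t
  induction t with
  | zero => intros; rfl
  | succ t ih =>
    intro ht x
    rw [orbitLetter_succ, ih (by omega), orbitLetter_succ σ, Perm.mul_apply]
    by_cases hp : x = p
    · subst hp; rw [swap_apply_left]; exact (h t ht).symm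
    by_cases hq : x = q
    · subst hq; rw [swap_apply_right]; exact h t ht
    · rw [swap_apply_of_ne_of_ne hp hq]

theorem IsDeBruijnCoding.mul_swap (hc : IsDeBruijnCoding n σ l)
    (h : ∀ t < n, orbitLetter σ l (σ p) t = orbitLetter σ l (σ q) t) :
    IsDeBruijnCoding n (σ * swap p q) l := by
  have e := orbitLetter_mul_swap h
  refine ⟨fun x y hxy => hc.eq_of_agree x y fun t ht => ?_, fun u => ?_⟩
  · rw [← e t (by omega), ← e t (by omega), hxy t ht]
  · obtain ⟨x, hx⟩ := hc.exists_word u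
    exact ⟨x, fun t ht => by rw [e t ht.le, hx t ht]⟩

/-- Cycles replace the missing letter of agreement: points with equal new words share a `σ`-cycle,
and so do their images, which fails if the swap moves just one of them. -/
theorem IsDeBruijnCoding.mul_swap' (hc : IsDeBruijnCoding (n + 1) σ l)
    (hs : ∀ x y, (∀ t < n + 1, orbitLetter σ l x t = orbitLetter σ l y t) → σ.SameCycle x y)
    (hpq : ¬ σ.SameCycle p q)
    (h : ∀ t < n, orbitLetter σ l (σ p) t = orbitLetter σ l (σ q) t) :
    IsDeBruijnCoding (n + 1) (σ * swap p q) l := by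
  have e := orbitLetter_mul_swap h
  refine ⟨fun x y hxy => ?_, fun u => ?_⟩
  · have h1 : σ.SameCycle x y := hs x y fun t ht => by
      rw [← e t (by omega), ← e t (by omega), hxy t (by omega)]
    have h2 : ∀ t < n + 1,
        orbitLetter σ l (σ (swap p q x)) t = orbitLetter σ l (σ (swap p q y)) t := by
      intro t ht
      have := hxy (t + 1) (by omega)
      rwa [orbitLetter_succ, orbitLetter_succ, e t (by omega), e t (by omega)] at this
    have h3 : σ.SameCycle (swap p q x) (swap p q y) := by
      simpa using hs _ _ h2
    have off {x y : I} (h1 : σ.SameCycle x y)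
        (h3 : σ.SameCycle (swap p q x) (swap p q y)) (hx : x = p ∨ x = q) : x = y := by
      by_contra hne
      rcases hx with rfl | rfl
      · have hy : y ≠ q := by rintro rfl; exact hpq h1
        rw [swap_apply_left, swap_apply_of_ne_of_ne (Ne.symm hne) hy] at h3
        exact hpq (h1.trans h3.symm)
      · have hy : y ≠ p := by rintro rfl; exact hpq h1.symm
        rw [swap_apply_right, swap_apply_of_ne_of_ne hy (Ne.symm hne)] at h3
        exact hpq (h3.trans h1.symm)
    by_cases hx : x = p ∨ x = q
    · exact off h1 h3 hx
    by_cases hy : y = p ∨ y = q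
    · exact (off h1.symm h3.symm hy).symm
    push Not at hx hy
    rw [swap_apply_of_ne_of_ne hx.1 hx.2, swap_apply_of_ne_of_ne hy.1 hy.2] at h2
    refine hc.eq_of_agree x y fun t ht => ?_
    cases t with
    | zero => exact hxy 0 (by omega)
    | succ t => rw [orbitLetter_succ, orbitLetter_succ, h2 t (by omega)]
  · obtain ⟨x, hx⟩ := hc.exists_word u
    exact ⟨x, fun t ht => by rw [e t (by omega), hx t ht]⟩

/-- If no two cycles of a coding can be joined by a swap, then there is only one cycle. -/
theorem IsDeBruijnCoding.sameCycle (hc : IsDeBruijnCoding n σ l)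
    (hmax : ∀ p q, ¬ σ.SameCycle p q → ¬ IsDeBruijnCoding n (σ * swap p q) l) (p q : I) :
    σ.SameCycle p q := by
  have h0 : ∀ p q, (∀ t < n, orbitLetter σ l p t = orbitLetter σ l q t) →
      σ.SameCycle p q := by
    intro p q h
    by_contra hpq
    have hpq' : ¬ σ.SameCycle (σ⁻¹ p) (σ⁻¹ q) := by simpa using hpq
    exact hmax _ _ hpq' (hc.mul_swap (by simpa using h))
  cases n with
  | zero => exact h0 p q (by simp)
  | succ n =>
    -- A descent starting from `h0` would have to prescribe `n + 2` letters, one more than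
    -- `exists_word` allows.
    have h1 : ∀ p q, (∀ t < n, orbitLetter σ l p t = orbitLetter σ l q t) →
        σ.SameCycle p q := by
      intro p q h
      by_contra hpq
      have hpq' : ¬ σ.SameCycle (σ⁻¹ p) (σ⁻¹ q) := by simpa using hpq
      exact hmax _ _ hpq' (hc.mul_swap' h0 hpq' (by simpa using h))
    have step : ∀ d ≤ n, ∀ p q,
        (∀ t < n - d, orbitLetter σ l p t = orbitLetter σ l q t) → σ.SameCycle p q := by
      intro d
      induction d with
      | zero => intro _; simpa using h1
      | succ d ih =>
        intro hd p q h
        -- `y` links `σ⁻¹ p` to `q`: it reads the letter before `p`, then the word of `q`.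
        obtain ⟨y, hy⟩ := hc.exists_word fun t => match t with
          | 0 => l (σ⁻¹ p)
          | t + 1 => orbitLetter σ l q t
        have hyp : σ.SameCycle y (σ⁻¹ p) := ih (by omega) _ _ fun t ht => by
          rw [hy t (by omega)]
          cases t with
          | zero => rfl
          | succ t => simp [orbitLetter_succ, h t (by omega)]
        have hyq : σ.SameCycle (σ y) q := ih (by omega) _ _ fun t ht => by
          rw [← orbitLetter_succ, hy (t + 1) (by omega)]
        have a : σ.SameCycle y p := by simpa using hyp
        have b : σ.SameCycle y q := by simpa using hyq
        exact a.symm.trans b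
    exact step n le_rfl p q (by simp)

/-- The cycles of a coding can be joined into a single one. -/
theorem IsDeBruijnCoding.exists_sameCycle [Finite I] (hc : IsDeBruijnCoding n σ l) :
    ∃ τ : Perm I, IsDeBruijnCoding n τ l ∧ ∀ p q, τ.SameCycle p q := by
  obtain ⟨τ, hτ, hmax⟩ := Set.exists_max_image {τ : Perm I | IsDeBruijnCoding n τ l}
    (fun τ => {x : I × I | τ.SameCycle x.1 x.2}.ncard) (Set.toFinite _) ⟨σ, hc⟩
  refine ⟨τ, hτ, hτ.sameCycle fun p q hpq hcode => ?_⟩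
  refine (hmax _ hcode).not_gt (Set.ncard_lt_ncard ?_ (Set.toFinite _))
  refine ⟨fun x hx => Perm.SameCycle.mul_swap hpq hx, fun hsub => hpq ?_⟩
  exact hsub (show (p, q) ∈ _ from (Perm.sameCycle_mul_swap hpq).symm)

end Words

theorem IsDeBruijnCoding.exists_isGeneralizedDeBruijn {I : Type*} [Fintype I] {k n N : ℕ}
    {σ : Perm I} {l : I → Fin k} (hc : IsDeBruijnCoding n σ l) (hs : ∀ p q, σ.SameCycle p q)
    (hcard : Fintype.card I = N) (hN : 0 < N) (h1 : k ^ n ≤ N) (h2 : N < k ^ (n + 1)) :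
    ∃ w : Fin N → Fin k, IsGeneralizedDeBruijn w := by
  have hk : 0 < k := Nat.pos_of_ne_zero fun h => by simp [h] at h2
  obtain ⟨p⟩ : Nonempty I := Fintype.card_pos_iff.1 (hcard ▸ hN)
  have hon : σ.IsCycleOn (Finset.univ : Finset I) :=
    ⟨by simp, fun x _ y _ => hs x y⟩
  have hcardu : (Finset.univ : Finset I).card = N := hcard
  have hmod (m : ℕ) : (σ ^ (m % N)) p = (σ ^ m) p :=
    (hon.pow_apply_eq_pow_apply (Finset.mem_univ p)).2 (by rw [hcardu]; exact Nat.mod_modEq m N)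
  refine ⟨fun j => l ((σ ^ (j : ℕ)) p), fun i _ => ?_⟩
  have hf (j : Fin N) (t : Fin i) :
      circularFactor (fun j : Fin N => l ((σ ^ (j : ℕ)) p)) i j t =
        orbitLetter σ l ((σ ^ (j : ℕ)) p) t := by
    simp only [circularFactor, orbitLetter, hmod]
    rw [← Perm.mul_apply, ← pow_add, add_comm]
  unfold circularComplexity
  rcases le_or_gt i n with hi | hi
  · rw [min_eq_left ((Nat.pow_le_pow_right hk hi).trans h1), Finset.image_univ_of_surjective]
    · simp
    · intro u
      obtain ⟨x, hx⟩ := hc.exists_word fun t => if ht : t < i then u ⟨t, ht⟩ else ⟨0, hk⟩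
      obtain ⟨m, hm, rfl⟩ := hon.exists_pow_eq (Finset.mem_univ p) (Finset.mem_univ x)
      refine ⟨⟨m, hcardu ▸ hm⟩, funext fun t => ?_⟩
      rw [hf]
      simpa using hx t (by omega)
  · rw [min_eq_right (h2.le.trans (Nat.pow_le_pow_right hk hi)), Finset.card_image_of_injective]
    · simp
    · intro a b hab
      have := hc.eq_of_agree ((σ ^ (a : ℕ)) p) ((σ ^ (b : ℕ)) p) fun t ht => by
        have := congrFun hab ⟨t, by omega⟩
        rwa [hf, hf] at this
      have := (hon.pow_apply_eq_pow_apply (Finset.mem_univ p)).1 this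
      rw [hcardu] at this
      exact Fin.ext (Nat.ModEq.eq_of_lt_of_lt this a.2 b.2)

theorem mainTheorem3 (k N : ℕ) (hk : 2 ≤ k) (hN : 1 ≤ N) :
    ∃ w : Fin N → Fin k, IsGeneralizedDeBruijn w := by
  classical
  have : NeZero k := ⟨by omega⟩
  have h1 : k ^ Nat.log k N ≤ N := Nat.pow_log_le_self k (by omega)
  have h2 : N < k ^ (Nat.log k N + 1) := Nat.lt_pow_succ_log_self hk N
  obtain ⟨I, _, σ, l, hcard, hc, -⟩ := exists_isDeBruijnCoding (Nat.log k N) N h1 h2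
  obtain ⟨τ, hτ, hs⟩ := hc.exists_sameCycle
  exact hτ.exists_isGeneralizedDeBruijn hs hcard hN h1 h2
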